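/- A symmetric $(v,k,\lambda)$ design over a set $V$ of $v$ points is a collection of $v$ distinct $k$-subsets of $V$ (blocks) such that every pair of distinct points lies in exactly $\lambda$ blocks. For an ordering $p_1,\ldots,p_v$ of the points and $B_1,\ldots,B_v$ of the blocks, its incidence matrix is the $\{0,1\}$-matrix with $(i,j)$ entry $1$ if $p_i\in B_j$ and $0$ otherwise. Let $\mathcal{C}^3(16,6,2)$ be the set of functions $C:\{1,\ldots,16\}^3\to\{0,1\}$ such that every $16\times 16$ matrix obtained from $C$ by fixing one of the three coordinates and varying the other two (in either order) is an incidence matrix of a symmetric $(16,6,2)$ design. Two such cubes are equivalent if one is obtained from the other by permuting the values $\{1,\ldots,16\}$ of each coordinate (by a separate permutation for each coordinate) and permuting the three coordinates. A $(16,6,2)$ difference set in a group $G$ of order $16$ is a $6$-subset $D\subseteq G$ such that every $g\in G\setminus\{1\}$ is equal to $d_1^{-1}d_2$ for exactly two pairs $(d_1,d_2)\in D\times D$. A group cube is a cube of the form $$C(i_1,i_2,i_3)=\begin{cases}1 & \text{if } g_{i_2}g_{i_3}\in B_{i_1},\\ 0 & \text{otherwise,}\end{cases}$$ where $G=\{g_1,\ldots,g_{16}\}$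 is a group of order $16$ and $\{B_1,\ldots,B_{16}\}$ is a symmetric $(16,6,2)$ design over $G$ all of whose blocks are $(16,6,2)$ difference sets in $G$. Proposition. The set $\mathcal{C}^3(16,6,2)$ contains at least $1423$ pairwise inequivalent cubes that are not equivalent to any group cube. -/

import Mathlib

/-! Cubes of symmetric designs. The set `{1, …, v}` is modelled by `Fin v`, the set of positions
`{1, …, n}` by `Fin n`, and the values `0`, `1` by `false`, `true`. -/

namespace SymCube

/-- `D` is (the set of blocks of) a symmetric `(v, k, l)` design over the point set `V`: there are
`v` points and `v` blocks, each block is a `k`-subset of `V`, and every pair of distinct points is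
contained in exactly `l` blocks. -/
structure IsSymmetricDesign {V : Type*} [Fintype V] [DecidableEq V] (v k l : ℕ)
    (D : Finset (Finset V)) : Prop where
  card_points : Fintype.card V = v
  card_blocks : D.card = v
  card_block : ∀ B ∈ D, B.card = k
  card_pair : ∀ p q : V, p ≠ q → (D.filter (fun B => p ∈ B ∧ q ∈ B)).card = l

/-- `A` is the incidence matrix of a symmetric `(v, k, l)` design, for some ordering
of its points and of its blocks: `A i j = [p i ∈ B j]`. (Without loss of generality the point set
is `Fin v`.) -/
def IsIncidenceMatrix (v k l : ℕ) (A : Matrix (Fin v) (Fin v) Bool) : Prop :=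
  ∃ D : Finset (Finset (Fin v)), IsSymmetricDesign v k l D ∧
    ∃ (p : Fin v ≃ Fin v) (B : Fin v ≃ {b : Finset (Fin v) // b ∈ D}),
      ∀ i j, A i j = decide (p i ∈ (B j : Finset (Fin v)))

/-- An `n`-cube of order `v`. -/
abbrev Cube (n v : ℕ) : Type := (Fin n → Fin v) → Bool

/-- The slice of `C` in which the positions `x` (rows) and `y` (columns) vary and the other
coordinates are fixed to the values given by `c` (the values `c x` and `c y` are irrelevant). -/
def slice {n v : ℕ} (C : Cube n v) (x y : Fin n) (c : Fin n → Fin v) :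
    Matrix (Fin v) (Fin v) Bool :=
  fun a b => C (Function.update (Function.update c x a) y b)

/-- The set `𝒞ⁿ(v, k, l)` of `n`-dimensional cubes of symmetric `(v, k, l)` designs. -/
def designCubes (n v k l : ℕ) : Set (Cube n v) :=
  {C | ∀ x y : Fin n, x ≠ y → ∀ c : Fin n → Fin v, IsIncidenceMatrix v k l (slice C x y c)}

/-- Action of `(S_v)ⁿ`: `C^α (i₁, …, iₙ) = C (α₁⁻¹ i₁, …, αₙ⁻¹ iₙ)`. -/
def isotope {n v : ℕ} (α : Fin n → Equiv.Perm (Fin v)) (C : Cube n v) : Cube n v :=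
  fun i => C (fun x => (α x)⁻¹ (i x))

/-- Action of `S_n`: `C^γ (i₁, …, iₙ) = C (i_{γ⁻¹ 1}, …, i_{γ⁻¹ n})`. -/
def conjugate {n v : ℕ} (γ : Equiv.Perm (Fin n)) (C : Cube n v) : Cube n v :=
  fun i => C (fun x => i (γ⁻¹ x))

/-- Equivalence (paratopy) of cubes: one is mapped to the other by a combination of an isotopy and
a conjugation. -/
def Equivalent {n v : ℕ} (C C' : Cube n v) : Prop :=
  ∃ (α : Fin n → Equiv.Perm (Fin v)) (γ : Equiv.Perm (Fin n)), C' = conjugate γ (isotope α C)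

/-- `D` is a `(v, k, l)` difference set in the group `G` of order `v`: a `k`-subset such that every
`g ≠ 1` is `d₁⁻¹ * d₂` for exactly `l` pairs `(d₁, d₂)` of elements of `D`. -/
structure IsDifferenceSet {G : Type*} [Group G] [Fintype G] [DecidableEq G] (v k l : ℕ)
    (D : Finset G) : Prop where
  card_group : Fintype.card G = v
  card_set : D.card = k
  card_diff : ∀ g : G, g ≠ 1 → ((D ×ˢ D).filter (fun d => d.1⁻¹ * d.2 = g)).card = l

/-- `C` is a group cube of dimension `m + 1`: for some group `G` with elements listed as
`g₁, …, g_v` and some symmetric `(v, k, l)` design over `G` with blocks listed as `B₁, …, B_v`, all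
of which are `(v, k, l)` difference sets in `G`, one has
`C (i₁, …, iₙ) = [g_{i₂} * ⋯ * g_{iₙ} ∈ B_{i₁}]`, where `n = m + 1`. -/
def IsGroupCube {m v : ℕ} (k l : ℕ) (C : Cube (m + 1) v) : Prop :=
  ∃ (G : Type) (_ : Group G) (_ : Fintype G) (_ : DecidableEq G)
    (g : Fin v ≃ G) (D : Finset (Finset G)) (B : Fin v ≃ {b : Finset G // b ∈ D}),
      IsSymmetricDesign v k l D ∧ (∀ b ∈ D, IsDifferenceSet v k l b) ∧
      ∀ i : Fin (m + 1) → Fin v,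
        C i = decide ((List.ofFn (fun j : Fin m => g (i j.succ))).prod ∈ (B (i 0) : Finset G))

/-- The set of non-group cubes in `𝒞ⁿ(v, k, l)`, `n = m + 1`: the cubes of symmetric `(v, k, l)`
designs that are not equivalent to any group cube. -/
def nonGroupCubes (m v k l : ℕ) : Set (Cube (m + 1) v) :=
  {C | C ∈ designCubes (m + 1) v k l ∧
    ∀ C' : Cube (m + 1) v, IsGroupCube k l C' → ¬ Equivalent C C'}

end SymCube

namespace SymCube

open Finset

/-! ### Incidence matrices from row and column counts -/

/-! Label the indices by pairs `(x, y)` of elements of `V4`. The bent form `⟨x, y⟩` takes the value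
1 six times, and `⟨∑ xₜ, ∑ yₜ⟩` is a cube of (16,6,2) designs. For fixed `x`'s the entry is affine
in `y`. Adding a function `H` of the `x`'s only complements such affine pieces, which preserves all
counts as long as `H` vanishes on the degenerate piece `∑ xₜ = 0` (`twist_mem_designCubes`). This
leaves 48 free bits.

Inequivalence comes from flat boxes. Summing over the four corners of a box in two directions makes
the quadratic part independent of the third coordinate, so flatness depends on `H` alone
(`isFlatBox_twist`). Counting flat boxes through each plane and symmetrising over the directions
gives a paratopy invariant (`Equivalent.flatInvariant_eq`).

In a group cube, `(a * s) * (s⁻¹ * b) = a * b` gives autotopies transitive on the values of two of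
the three coordinates. A cube whose plane counts are nonconstant in two directions is therefore not
equivalent to a group cube (`mem_nonGroupCubes_of_flatCount_ne`).

It remains to exhibit 1423 functions `H`, coded as 64-bit numbers, with distinct invariants and
nonconstant counts. Both are computed from the code by bit operations (`flatInvariant_codeCube`,
`flatCount_twist_bitTwist`) and checked by evaluation (`checkCodes_codes`). -/

theorem isIncidenceMatrix_of_counts {v k l : ℕ} (hlk : l < k) (A : Matrix (Fin v) (Fin v) Bool)
    (hcol : ∀ j, #{i | A i j = true} = k)
    (hrows : ∀ i i', i ≠ i' → #{j | A i j = true ∧ A i' j = true} = l)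
    (hcols : ∀ j j', j ≠ j' → #{i | A i j = true ∧ A i j' = true} = l) :
    IsIncidenceMatrix v k l A := by
  classical
  let b : Fin v → Finset (Fin v) := fun j => {i | A i j = true}
  have hb : Function.Injective b := by
    intro j j' h
    by_contra hne
    -- Equal columns would meet in `k` points rather than `l`, so `l < k` makes the blocks distinct.
    have h2 : ({i | A i j = true ∧ A i j' = true} : Finset (Fin v)) = b j := by
      rw [filter_and, show ({i | A i j' = true} : Finset (Fin v)) = b j from h.symm]
      exact inter_self _
    have h3 := hcols j j' hne
    rw [h2, hcol j] at h3
    omega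
  refine ⟨univ.image b, ⟨Fintype.card_fin v, ?_, ?_, ?_⟩, Equiv.refl _,
    (Equiv.ofInjective b hb).trans (Equiv.subtypeEquivRight (by simp)), ?_⟩
  · rw [card_image_of_injective _ hb, card_fin]
  · intro B hB
    obtain ⟨j, -, rfl⟩ := mem_image.1 hB
    exact hcol j
  · intro p q hpq
    rw [← hrows p q hpq, filter_image, card_image_of_injective _ hb]
    simp [b]
  · intro i j
    simp [b]

/-! ### Twisted bilinear cubes -/

/-- The Klein four-group. -/
abbrev V4 : Type := ZMod 2 × ZMod 2

/-- The standard bilinear form on `V4`. -/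
def bilin (u v : V4) : ZMod 2 := u.1 * v.1 + u.2 * v.2

/-- A labelling of the sixteen indices by pairs of elements of `V4`. -/
noncomputable def coord : Fin 16 ≃ V4 × V4 :=
  Fintype.equivOfCardEq (by simp)

/-- The cube with entries `⟨∑ xₜ, ∑ yₜ⟩ + H x` at the indices labelled `(xₜ, yₜ)`. -/
noncomputable def twist (H : (Fin 3 → V4) → ZMod 2) : Cube 3 16 := fun i =>
  decide (bilin (∑ t, (coord (i t)).1) (∑ t, (coord (i t)).2) +
    H (fun t => (coord (i t)).1) = 1)

/-- For `L ≠ 0` the function of `y` is affine and nonconstant, hence balanced whatever `κ` is. For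
`L = 0` it is the constant `κ`, which has to be 0. -/
theorem block_count : ∀ (L c : V4) (κ : ZMod 2), (L = 0 → κ = 0) →
    (∑ y : V4, if bilin L (c + y) + κ = 1 then 1 else 0) = if L = 0 then 0 else 2 := by
  decide +kernel

theorem block_pair_count_same : ∀ (L c c' : V4) (κ : ZMod 2), (L = 0 → κ = 0) →
    (∑ y : V4, if bilin L (c + y) + κ = 1 ∧ bilin L (c' + y) + κ = 1 then 1 else 0) =
      if L = 0 then 0 else if bilin L (c + c') = 0 then 2 else 0 := by
  decide +kernel

/-- Distinct nonzero `L`, `L'` are linearly independent, so the two affine functions take each pair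
of values exactly once. -/
theorem block_pair_count_ne : ∀ (L L' c c' : V4) (κ κ' : ZMod 2), (L = 0 → κ = 0) →
    (L' = 0 → κ' = 0) → L ≠ L' →
    (∑ y : V4, if bilin L (c + y) + κ = 1 ∧ bilin L' (c' + y) + κ' = 1 then 1 else 0) =
      if L = 0 ∨ L' = 0 then 0 else 1 := by
  decide +kernel

theorem sum_block_count : ∀ a : V4, (∑ y : V4, if a + y = 0 then 0 else 2) = 6 := by
  decide +kernel

/-- Exactly one nonzero vector of `V4` is orthogonal to a given `d ≠ 0`. -/
theorem sum_block_pair_count_same : ∀ a d : V4, d ≠ 0 →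
    (∑ y : V4, if a + y = 0 then 0 else if bilin (a + y) d = 0 then 2 else 0) = 2 := by
  decide +kernel

theorem sum_block_pair_count_ne : ∀ a a' : V4, a ≠ a' →
    (∑ y : V4, if a + y = 0 ∨ a' + y = 0 then 0 else 1) = 2 := by
  decide +kernel

theorem V4.add_eq_zero_iff : ∀ a b : V4, a + b = 0 ↔ a = b := by decide +kernel

/-- The entries of a slice of a twisted bilinear cube. -/
def sliceForm (w : V4 × V4) (κ : V4 → V4 → ZMod 2) (x y : V4 × V4) : ZMod 2 :=
  bilin (x.1 + y.1 + w.1) (x.2 + y.2 + w.2) + κ x.1 y.1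

section sliceForm

variable (w : V4 × V4) (κ : V4 → V4 → ZMod 2) (hκ : ∀ a b, a + b + w.1 = 0 → κ a b = 0)

include hκ

theorem sliceForm_count (x : V4 × V4) :
    (∑ y : V4 × V4, if sliceForm w κ x y = 1 then 1 else 0) = 6 := by
  rw [Fintype.sum_prod_type, ← sum_block_count (x.1 + w.1)]
  refine sum_congr rfl fun y _ => ?_
  rw [← block_count (x.1 + w.1 + y) (x.2 + w.2) (κ x.1 y)
    (fun h => hκ _ _ (by rw [← h]; abel))]
  refine sum_congr rfl fun z _ => ?_
  rw [sliceForm, add_right_comm x.1, add_right_comm x.2]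

theorem sliceForm_pair_count (x x' : V4 × V4) (hx : x ≠ x') :
    (∑ y : V4 × V4, if sliceForm w κ x y = 1 ∧ sliceForm w κ x' y = 1 then 1 else 0) = 2 := by
  rw [Fintype.sum_prod_type]
  simp only [sliceForm, add_right_comm _ _ w.1, add_right_comm _ _ w.2]
  obtain ⟨a, b⟩ := x
  obtain ⟨a', b'⟩ := x'
  -- Rows with equal first components meet in parallel pieces, so one orthogonal direction
  -- contributes 2. Otherwise the pieces are transversal, and the two values of `y` with both pieces
  -- nondegenerate contribute 1 each.
  by_cases h : a = a'
  · subst h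
    have hd : b + w.2 + (b' + w.2) ≠ 0 := by
      rw [Ne, V4.add_eq_zero_iff]
      intro h
      exact hx (by rw [add_right_cancel h])
    refine Eq.trans ?_ (sum_block_pair_count_same (a + w.1) _ hd)
    exact sum_congr rfl fun y _ =>
      block_pair_count_same _ _ _ _ (fun h => hκ _ _ (by rw [← h]; abel))
  · have ha : a + w.1 ≠ a' + w.1 := fun h' => h (add_right_cancel h')
    refine Eq.trans ?_ (sum_block_pair_count_ne _ _ ha)
    exact sum_congr rfl fun y _ =>
      block_pair_count_ne _ _ _ _ _ _ (fun h => hκ _ _ (by rw [← h]; abel))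
        (fun h => hκ _ _ (by rw [← h]; abel)) (fun h' => ha (add_right_cancel h'))

theorem isIncidenceMatrix_sliceForm :
    IsIncidenceMatrix 16 6 2 (fun a b => decide (sliceForm w κ (coord a) (coord b) = 1)) := by
  -- Transposing a slice only transposes `κ`, so column counts are instances of row counts.
  have hswap : ∀ x y, sliceForm w κ x y = sliceForm w (fun a b => κ b a) y x := fun x y => by
    simp only [sliceForm, add_comm x.1, add_comm x.2]
  have hκ' : ∀ a b, a + b + w.1 = 0 → κ b a = 0 := fun a b h => hκ _ _ (by rw [← h]; abel)
  refine isIncidenceMatrix_of_counts (by norm_num) _ (fun j => ?_) (fun i i' h => ?_)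
    (fun j j' h => ?_)
  · simp only [decide_eq_true_eq, card_filter, hswap _ (coord j)]
    rw [coord.sum_comp (fun y => if sliceForm w (fun a b => κ b a) (coord j) y = 1 then 1 else 0)]
    exact sliceForm_count w _ hκ' _
  · simp only [decide_eq_true_eq, card_filter]
    rw [coord.sum_comp (fun y => if sliceForm w κ (coord i) y = 1 ∧
      sliceForm w κ (coord i') y = 1 then 1 else 0)]
    exact sliceForm_pair_count w κ hκ _ _ (coord.injective.ne h)
  · simp only [decide_eq_true_eq, card_filter, hswap _ (coord j), hswap _ (coord j')]
    rw [coord.sum_comp (fun y => if sliceForm w (fun a b => κ b a) (coord j) y = 1 ∧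
      sliceForm w (fun a b => κ b a) (coord j') y = 1 then 1 else 0)]
    exact sliceForm_pair_count w _ hκ' _ _ (coord.injective.ne h)

end sliceForm

theorem sum_update_update {M : Type*} [AddCommMonoid M] {x y : Fin 3} (hxy : x ≠ y) :
    ∃ z, ∀ (f : Fin 3 → M) (a b : M),
      ∑ t, Function.update (Function.update f x a) y b t = a + b + f z := by
  have hz : ∃ z, z ≠ x ∧ z ≠ y ∧ (univ : Finset (Fin 3)) = {x, y, z} := by
    revert x y; decide
  obtain ⟨z, hzx, hzy, hu⟩ := hz
  refine ⟨z, fun f a b => ?_⟩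
  rw [hu, sum_insert (by simp [hxy, hzx.symm]), sum_pair hzy.symm]
  simp [Function.update_of_ne, hxy, hzx, hzy, add_assoc]

/-- Fixing the third coordinate merely translates the bilinear form by its label, so each slice is a
`sliceForm`. -/
theorem twist_mem_designCubes {H : (Fin 3 → V4) → ZMod 2} (hH : ∀ s, ∑ t, s t = 0 → H s = 0) :
    twist H ∈ designCubes 3 16 6 2 := by
  intro x y hxy c
  obtain ⟨z, hz⟩ := sum_update_update (M := V4) hxy
  have hu : ∀ (g : V4 × V4 → V4) (a b : Fin 16),
      (fun t => g (coord (Function.update (Function.update c x a) y b t))) =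
      Function.update (Function.update (fun t => g (coord (c t))) x (g (coord a))) y
        (g (coord b)) := fun g a b => by
    refine (Function.comp_update (fun i => g (coord i)) (Function.update c x a) y b).trans ?_
    rw [Function.comp_update]
    rfl
  have key : slice (twist H) x y c = fun a b => decide (sliceForm (coord (c z))
      (fun u v => H (Function.update (Function.update (fun t => (coord (c t)).1) x u) y v))
      (coord a) (coord b) = 1) := by
    funext a b
    have h1 := hu Prod.fst a b
    have h2 := hu Prod.snd a b
    simp only [slice, twist, sliceForm, h1, h2]
    rw [hz, hz]
    rfl
  rw [key]
  exact isIncidenceMatrix_sliceForm _ _ fun u v h => hH _ (by rw [hz, h])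

/-! ### Isotopies, conjugations and flat boxes -/

theorem isotope_isotope {n v : ℕ} (α β : Fin n → Equiv.Perm (Fin v)) (C : Cube n v) :
    isotope α (isotope β C) = isotope (α * β) C := by
  funext i
  simp [isotope]

theorem isotope_one {n v : ℕ} (C : Cube n v) : isotope 1 C = C := by
  funext i
  simp [isotope]

theorem conjugate_conjugate {n v : ℕ} (γ δ : Equiv.Perm (Fin n)) (C : Cube n v) :
    conjugate γ (conjugate δ C) = conjugate (δ * γ) C := by
  funext i
  simp [conjugate]

theorem conjugate_one {n v : ℕ} (C : Cube n v) : conjugate 1 C = C := by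
  funext i
  simp [conjugate]

theorem conjugate_isotope {n v : ℕ} (γ : Equiv.Perm (Fin n)) (α : Fin n → Equiv.Perm (Fin v))
    (C : Cube n v) :
    conjugate γ (isotope α C) = isotope (fun x => α (γ x)) (conjugate γ C) := by
  funext i
  simp [conjugate, isotope]

/-- The sum over the corners of a `2 × 2` box of lines in the last direction. -/
def boxSum {v : ℕ} (C : Cube 3 v) (i i' j j' k : Fin v) : Bool :=
  C ![i, j, k] ^^ C ![i, j', k] ^^ C ![i', j, k] ^^ C ![i', j', k]

/-- The sum over the corners of a `2 × 2` box of lines is constant. -/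
def IsFlatBox {v : ℕ} (C : Cube 3 v) (i i' j j' : Fin v) : Prop :=
  ∀ k k', boxSum C i i' j j' k = boxSum C i i' j j' k'

open Classical in
/-- The number of flat boxes through the plane with first coordinate `i`. -/
noncomputable def flatCount {v : ℕ} (C : Cube 3 v) (i : Fin v) : ℕ :=
  ∑ i', ∑ j, ∑ j', if IsFlatBox C i i' j j' then 1 else 0

theorem boxSum_isotope {v : ℕ} (α : Fin 3 → Equiv.Perm (Fin v)) (C : Cube 3 v)
    (i i' j j' k : Fin v) :
    boxSum (isotope α C) (α 0 i) (α 0 i') (α 1 j) (α 1 j') (α 2 k) = boxSum C i i' j j' k := by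
  have h : ∀ i j k : Fin v, isotope α C ![α 0 i, α 1 j, α 2 k] = C ![i, j, k] := fun i j k => by
    unfold isotope
    congr 1
    funext x
    fin_cases x <;> simp
  simp only [boxSum, h]

theorem isFlatBox_isotope {v : ℕ} (α : Fin 3 → Equiv.Perm (Fin v)) (C : Cube 3 v)
    (i i' j j' : Fin v) :
    IsFlatBox (isotope α C) (α 0 i) (α 0 i') (α 1 j) (α 1 j') ↔ IsFlatBox C i i' j j' := by
  refine ⟨fun h k k' => by simpa only [boxSum_isotope] using h (α 2 k) (α 2 k'), fun h k k' => ?_⟩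
  obtain ⟨k, rfl⟩ := (α 2).surjective k
  obtain ⟨k', rfl⟩ := (α 2).surjective k'
  simpa only [boxSum_isotope] using h k k'

open Classical in
theorem flatCount_isotope {v : ℕ} (α : Fin 3 → Equiv.Perm (Fin v)) (C : Cube 3 v) (i : Fin v) :
    flatCount (isotope α C) (α 0 i) = flatCount C i := by
  unfold flatCount
  rw [← Equiv.sum_comp (α 0)]
  refine sum_congr rfl fun i' _ => ?_
  rw [← Equiv.sum_comp (α 1)]
  refine sum_congr rfl fun j _ => ?_
  rw [← Equiv.sum_comp (α 1)]
  simp only [isFlatBox_isotope]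

/-- The mixed moment of the numbers of flat boxes in the two directions across the first one. -/
noncomputable def flatMoment {v : ℕ} (C : Cube 3 v) : ℕ :=
  ∑ i, flatCount C i ^ 2 * flatCount (conjugate (Equiv.swap 1 2) C) i

theorem flatMoment_isotope {v : ℕ} (α : Fin 3 → Equiv.Perm (Fin v)) (C : Cube 3 v) :
    flatMoment (isotope α C) = flatMoment C := by
  unfold flatMoment
  rw [← Equiv.sum_comp (α 0)]
  refine sum_congr rfl fun i _ => ?_
  rw [flatCount_isotope, conjugate_isotope]
  congr 1
  -- The swap fixes direction 0, so both factors of the moment are reindexed by the same `α 0`.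
  exact flatCount_isotope (fun x => α (Equiv.swap 1 2 x)) _ i

/-- A paratopy invariant of three-dimensional cubes. -/
noncomputable def flatInvariant {v : ℕ} (C : Cube 3 v) : ℕ :=
  ∑ γ : Equiv.Perm (Fin 3), flatMoment (conjugate γ C) ^ 2

/-- Each moment is isotopy invariant, and a conjugation only permutes the six terms, by left
multiplication in `S₃`. -/
theorem Equivalent.flatInvariant_eq {v : ℕ} {C C' : Cube 3 v} (h : Equivalent C C') :
    flatInvariant C' = flatInvariant C := by
  obtain ⟨α, γ, rfl⟩ := h
  unfold flatInvariant
  rw [← Equiv.sum_comp (Equiv.mulLeft γ) (fun δ => flatMoment (conjugate δ C) ^ 2)]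
  refine sum_congr rfl fun δ _ => ?_
  rw [conjugate_conjugate, conjugate_isotope, flatMoment_isotope]
  rfl

/-! ### Group cubes are homogeneous in two directions -/

/-- The autotopies of `C` act transitively on the values of the coordinate `d`. -/
def IsHomogeneousAt {n v : ℕ} (C : Cube n v) (d : Fin n) : Prop :=
  ∀ y y', ∃ α : Fin n → Equiv.Perm (Fin v), isotope α C = C ∧ α d y = y'

theorem IsHomogeneousAt.flatCount_eq {v : ℕ} {C : Cube 3 v} (h : IsHomogeneousAt C 0)
    (i i' : Fin v) : flatCount C i = flatCount C i' := by
  obtain ⟨α, hα, rfl⟩ := h i i'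
  rw [← flatCount_isotope α C i, hα]

theorem IsHomogeneousAt.conjugate {n v : ℕ} {C : Cube n v} {d : Fin n}
    (h : IsHomogeneousAt C d) (γ : Equiv.Perm (Fin n)) :
    IsHomogeneousAt (conjugate γ C) (γ⁻¹ d) := by
  intro y y'
  obtain ⟨α, hα, hy⟩ := h y y'
  exact ⟨fun x => α (γ x), by rw [← conjugate_isotope, hα], by simpa using hy⟩

theorem IsHomogeneousAt.of_isotope {n v : ℕ} {C : Cube n v} {d : Fin n}
    {α : Fin n → Equiv.Perm (Fin v)} (h : IsHomogeneousAt (isotope α C) d) :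
    IsHomogeneousAt C d := by
  intro y y'
  obtain ⟨β, hβ, hy⟩ := h (α d y) (α d y')
  -- Autotopies of isotopic cubes are conjugate.
  refine ⟨α⁻¹ * (β * α), ?_, by simp [hy]⟩
  rw [← isotope_isotope, ← isotope_isotope, hβ, isotope_isotope, inv_mul_cancel, isotope_one]

theorem Equivalent.isHomogeneousAt {n v : ℕ} {C C' : Cube n v} (h : Equivalent C C') :
    ∃ γ : Equiv.Perm (Fin n), ∀ d, IsHomogeneousAt C' d → IsHomogeneousAt C (γ d) := by
  obtain ⟨α, γ, rfl⟩ := h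
  refine ⟨γ, fun d hd => ?_⟩
  have := hd.conjugate γ⁻¹
  rw [conjugate_conjugate, mul_inv_cancel, conjugate_one, inv_inv] at this
  exact this.of_isotope

/-- The factors `s⁻¹` and `s` inserted between the two group elements cancel; the block coordinate
stays fixed. -/
theorem IsGroupCube.exists_isotope {v k l : ℕ} {C : Cube 3 v} (h : IsGroupCube (m := 2) k l C) :
    ∃ (G : Type) (_ : Group G) (g : Fin v ≃ G), ∀ s : G,
      isotope ![1, (g.trans (Equiv.mulRight s)).trans g.symm,
        (g.trans (Equiv.mulLeft s⁻¹)).trans g.symm] C = C := by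
  obtain ⟨G, hG, _, _, g, D, B, -, -, hC⟩ := h
  refine ⟨G, hG, g, fun s => ?_⟩
  funext i
  simp only [isotope, hC]
  simp [List.ofFn_succ, Equiv.Perm.inv_def]

theorem IsGroupCube.isHomogeneousAt {v k l : ℕ} {C : Cube 3 v}
    (h : IsGroupCube (m := 2) k l C) : IsHomogeneousAt C 1 ∧ IsHomogeneousAt C 2 := by
  obtain ⟨G, _, g, hC⟩ := h.exists_isotope
  exact ⟨fun y y' => ⟨_, hC ((g y)⁻¹ * g y'), by simp⟩,
    fun y y' => ⟨_, hC (g y * (g y')⁻¹), by simp⟩⟩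

theorem mem_nonGroupCubes_of_flatCount_ne {v k l : ℕ} {C : Cube 3 v} (hC : C ∈ designCubes 3 v k l)
    {i i' j j' : Fin v} (h0 : flatCount C i ≠ flatCount C i')
    (h1 : flatCount (conjugate (finRotate 3) C) j ≠ flatCount (conjugate (finRotate 3) C) j') :
    C ∈ nonGroupCubes 2 v k l := by
  refine ⟨hC, fun C' hC' hE => ?_⟩
  obtain ⟨γ, hγ⟩ := hE.isHomogeneousAt
  have g1 := hγ 1 hC'.isHomogeneousAt.1
  have g2 := hγ 2 hC'.isHomogeneousAt.2
  have n0 : ¬ IsHomogeneousAt C 0 := fun h => h0 (h.flatCount_eq i i')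
  have n1 : ¬ IsHomogeneousAt C 1 := fun h => h1 ((h.conjugate (finRotate 3)).flatCount_eq j j')
  -- Two homogeneous directions cannot both avoid the two inhomogeneous ones among three.
  have hd : ∀ γ : Equiv.Perm (Fin 3), γ 1 = 0 ∨ γ 1 = 1 ∨ γ 2 = 0 ∨ γ 2 = 1 := by decide
  rcases hd γ with h | h | h | h
  · exact n0 (h ▸ g1)
  · exact n1 (h ▸ g1)
  · exact n0 (h ▸ g2)
  · exact n1 (h ▸ g2)

/-! ### Flat boxes of twisted bilinear cubes -/

/-- The sum of the twisting function over the corners of a box. -/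
def twistBox (H : (Fin 3 → V4) → ZMod 2) (u u' w w' s : V4) : ZMod 2 :=
  H ![u, w, s] + H ![u, w', s] + H ![u', w, s] + H ![u', w', s]

/-- The sum of the twisting function over the corners of a box of lines is constant. -/
def IsFlatTwist (H : (Fin 3 → V4) → ZMod 2) (u u' w w' : V4) : Prop :=
  ∀ s s', twistBox H u u' w w' s = twistBox H u u' w w' s'

/-- The form is quadratic, so a second difference in two directions does not see the third: every
term involving `k` occurs an even number of times. -/
theorem bilin_box (i i' j j' k k' : V4 × V4) :
    bilin (i.1 + j.1 + k.1) (i.2 + j.2 + k.2) + bilin (i.1 + j'.1 + k.1) (i.2 + j'.2 + k.2) +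
      bilin (i'.1 + j.1 + k.1) (i'.2 + j.2 + k.2) +
      bilin (i'.1 + j'.1 + k.1) (i'.2 + j'.2 + k.2) =
    bilin (i.1 + j.1 + k'.1) (i.2 + j.2 + k'.2) + bilin (i.1 + j'.1 + k'.1) (i.2 + j'.2 + k'.2) +
      bilin (i'.1 + j.1 + k'.1) (i'.2 + j.2 + k'.2) +
      bilin (i'.1 + j'.1 + k'.1) (i'.2 + j'.2 + k'.2) := by
  have h2 : (2 : ZMod 2) = 0 := rfl
  have h : ∀ k : V4 × V4,
      bilin (i.1 + j.1 + k.1) (i.2 + j.2 + k.2) + bilin (i.1 + j'.1 + k.1) (i.2 + j'.2 + k.2) +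
      bilin (i'.1 + j.1 + k.1) (i'.2 + j.2 + k.2) +
      bilin (i'.1 + j'.1 + k.1) (i'.2 + j'.2 + k.2) =
    bilin (i.1 + j.1) (i.2 + j.2) + bilin (i.1 + j'.1) (i.2 + j'.2) +
      bilin (i'.1 + j.1) (i'.2 + j.2) + bilin (i'.1 + j'.1) (i'.2 + j'.2) := fun k => by
    simp only [bilin, Prod.fst_add, Prod.snd_add]
    linear_combination
      ((i.1.1 + i'.1.1 + j.1.1 + j'.1.1) * k.2.1 + k.1.1 * (i.2.1 + i'.2.1 + j.2.1 + j'.2.1) +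
       (i.1.2 + i'.1.2 + j.1.2 + j'.1.2) * k.2.2 + k.1.2 * (i.2.2 + i'.2.2 + j.2.2 + j'.2.2) +
       2 * k.1.1 * k.2.1 + 2 * k.1.2 * k.2.2) * h2
  rw [h k, h k']

theorem decide_xor_decide : ∀ a b : ZMod 2,
    (decide (a = 1) ^^ decide (b = 1)) = decide (a + b = 1) := by
  decide

theorem decide_eq_decide_iff : ∀ a b : ZMod 2, decide (a = 1) = decide (b = 1) ↔ a = b := by
  decide

theorem twist_apply (H : (Fin 3 → V4) → ZMod 2) (i j k : Fin 16) :
    twist H ![i, j, k] = decide (bilin ((coord i).1 + (coord j).1 + (coord k).1)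
      ((coord i).2 + (coord j).2 + (coord k).2) +
      H ![(coord i).1, (coord j).1, (coord k).1] = 1) := by
  have h : (fun t => (coord ((![i, j, k] : Fin 3 → Fin 16) t)).1) =
      ![(coord i).1, (coord j).1, (coord k).1] := by
    funext t
    fin_cases t <;> rfl
  simp only [twist, h]
  simp [Fin.sum_univ_three]

theorem isFlatBox_twist (H : (Fin 3 → V4) → ZMod 2) (i i' j j' : Fin 16) :
    IsFlatBox (twist H) i i' j j' ↔
      IsFlatTwist H (coord i).1 (coord i').1 (coord j).1 (coord j').1 := by
  have key : ∀ k k', boxSum (twist H) i i' j j' k = boxSum (twist H) i i' j j' k' ↔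
      twistBox H (coord i).1 (coord i').1 (coord j).1 (coord j').1 (coord k).1 =
      twistBox H (coord i).1 (coord i').1 (coord j).1 (coord j').1 (coord k').1 := fun k k' => by
    have h := bilin_box (coord i) (coord i') (coord j) (coord j') (coord k) (coord k')
    simp only [boxSum, twist_apply, decide_xor_decide, decide_eq_decide_iff, twistBox]
    constructor
    · intro h'
      linear_combination h' - h
    · intro h'
      linear_combination h' + h
  constructor
  · intro h s s'
    -- Any second component would do, since `twistBox` sees only the first.
    simpa using (key (coord.symm (s, 0)) (coord.symm (s', 0))).1 (h _ _)
  · intro h k k'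
    exact (key k k').2 (h _ _)

theorem sum_coord_fst (f : V4 → ℕ) : ∑ i, f (coord i).1 = 4 * ∑ u, f u := by
  rw [coord.sum_comp (fun p => f p.1), Fintype.sum_prod_type]
  simp [mul_sum]

open Classical in
/-- The number of flat boxes of the twisting function through a plane. -/
noncomputable def twistCount (H : (Fin 3 → V4) → ZMod 2) (u : V4) : ℕ :=
  ∑ u', ∑ w, ∑ w', if IsFlatTwist H u u' w w' then 1 else 0

-- Each of `i'`, `j`, `j'` contributes a factor 4, the number of labels with a given first
-- component.
open Classical in
theorem flatCount_twist (H : (Fin 3 → V4) → ZMod 2) (i : Fin 16) :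
    flatCount (twist H) i = 64 * twistCount H (coord i).1 := by
  simp only [flatCount, twistCount, isFlatBox_twist]
  rw [sum_coord_fst (fun u' => ∑ j, ∑ j',
    if IsFlatTwist H (coord i).1 u' (coord j).1 (coord j').1 then 1 else 0)]
  have h1 : ∀ u', (∑ j, ∑ j',
      if IsFlatTwist H (coord i).1 u' (coord j).1 (coord j').1 then 1 else 0) =
      16 * ∑ w, ∑ w', if IsFlatTwist H (coord i).1 u' w w' then 1 else 0 := fun u' => by
    rw [sum_coord_fst (fun w => ∑ j', if IsFlatTwist H (coord i).1 u' w (coord j').1 then 1 else 0)]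
    simp_rw [fun w => sum_coord_fst
      (fun w' => if IsFlatTwist H (coord i).1 u' w w' then 1 else 0)]
    rw [← mul_sum, ← mul_assoc]
    norm_num
  simp only [h1]
  rw [← mul_sum, ← mul_assoc]
  norm_num

theorem conjugate_twist (γ : Equiv.Perm (Fin 3)) (H : (Fin 3 → V4) → ZMod 2) :
    conjugate γ (twist H) = twist (fun s => H (fun x => s (γ⁻¹ x))) := by
  funext i
  simp only [conjugate, twist]
  rw [Equiv.sum_comp γ⁻¹ (fun t => (coord (i t)).1), Equiv.sum_comp γ⁻¹ (fun t => (coord (i t)).2)]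

/-! ### Twisting functions stored in the bits of a natural number -/

/-- The number with binary digits `u`. -/
def V4.toNat (u : V4) : ℕ := 2 * u.1.val + u.2.val

theorem V4.sum_toNat (f : ℕ → ℕ) : ∑ u : V4, f u.toNat = f 0 + f 1 + f 2 + f 3 := by
  have h : (univ : Finset V4) = {(0, 0), (0, 1), (1, 0), (1, 1)} := by decide
  rw [h, sum_insert (by decide), sum_insert (by decide), sum_pair (by decide)]
  simp only [← add_assoc]
  rfl

theorem V4.toNat_lt : ∀ u : V4, u.toNat < 4 := by decide

theorem V4.exists_toNat : ∀ n < 4, ∃ u : V4, u.toNat = n := by decide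

/-- The twisting function with values read from the bits of `c`, with stride `a t` in the
direction `t`. -/
def bitTwist (c : ℕ) (a : Fin 3 → ℕ) (s : Fin 3 → V4) : ZMod 2 :=
  if c.testBit (∑ t, a t * (s t).toNat) then 1 else 0

/-- The bilinear part is symmetric in the directions, so conjugating permutes the strides and keeps
the code. -/
theorem conjugate_twist_bitTwist (γ : Equiv.Perm (Fin 3)) (c : ℕ) (a : Fin 3 → ℕ) :
    conjugate γ (twist (bitTwist c a)) = twist (bitTwist c (fun t => a (γ t))) := by
  rw [conjugate_twist]
  congr 1
  funext s
  unfold bitTwist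
  rw [← Equiv.sum_comp γ (fun t => a t * (s (γ⁻¹ t)).toNat)]
  simp

/-- The number with bits at the four positions `0`, `r`, `2 * r`, `3 * r`. -/
def bitMask (r : ℕ) : ℕ := 2 ^ (r * 0) ||| 2 ^ (r * 1) ||| 2 ^ (r * 2) ||| 2 ^ (r * 3)

/-- `1` if the box between the rows `j` and `j'` of the difference `d` of two planes is constant
on the bits of the mask `m`, and `0` otherwise. -/
def flatBit (m d j j' : ℕ) : ℕ :=
  bif (((d >>> j) ^^^ (d >>> j')) &&& m).beq 0 || (((d >>> j) ^^^ (d >>> j')) &&& m).beq m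
  then 1 else 0

/-- The number of flat boxes between two planes with difference `d`. -/
def pairCount (m q d : ℕ) : ℕ :=
  flatBit m d (q * 0) (q * 1) + flatBit m d (q * 0) (q * 2) + flatBit m d (q * 0) (q * 3) +
  flatBit m d (q * 1) (q * 2) + flatBit m d (q * 1) (q * 3) + flatBit m d (q * 2) (q * 3)

/-- Half the number of flat boxes through the plane `i`, for the strides `p`, `q`, `r`. -/
def planeCount (c p q r i : ℕ) : ℕ :=
  8 + (pairCount (bitMask r) q ((c >>> (p * i)) ^^^ (c >>> (p * 0))) +
    pairCount (bitMask r) q ((c >>> (p * i)) ^^^ (c >>> (p * 1))) +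
    pairCount (bitMask r) q ((c >>> (p * i)) ^^^ (c >>> (p * 2))) +
    pairCount (bitMask r) q ((c >>> (p * i)) ^^^ (c >>> (p * 3))))

/-- The mixed moment of the numbers of flat boxes, for the strides `p`, `q`, `r`. -/
def planeMoment (c p q r : ℕ) : ℕ :=
  planeCount c p q r 0 ^ 2 * planeCount c p r q 0 + planeCount c p q r 1 ^ 2 * planeCount c p r q 1 +
  planeCount c p q r 2 ^ 2 * planeCount c p r q 2 + planeCount c p q r 3 ^ 2 * planeCount c p r q 3

/-- The paratopy invariant of the cube with code `c`, up to a constant factor. -/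
def codeInvariant (c : ℕ) : ℕ :=
  planeMoment c 16 4 1 ^ 2 + planeMoment c 16 1 4 ^ 2 + planeMoment c 4 16 1 ^ 2 +
  planeMoment c 4 1 16 ^ 2 + planeMoment c 1 16 4 ^ 2 + planeMoment c 1 4 16 ^ 2

theorem testBit_bitMask (r k : ℕ) :
    (bitMask r).testBit k = true ↔ ∃ n < 4, r * n = k := by
  have h : (∃ n < 4, r * n = k) ↔ r * 0 = k ∨ r * 1 = k ∨ r * 2 = k ∨ r * 3 = k := by
    constructor
    · rintro ⟨n, hn, h⟩
      interval_cases n <;> simp [h]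
    · rintro (h | h | h | h)
      exacts [⟨0, by norm_num, h⟩, ⟨1, by norm_num, h⟩, ⟨2, by norm_num, h⟩, ⟨3, by norm_num, h⟩]
  rw [h, bitMask]
  simp only [Nat.testBit_or, Nat.testBit_two_pow, Bool.or_eq_true, decide_eq_true_eq, or_assoc]

/-- Four selected bits agree exactly when masking leaves none of them or all of them; this turns
flatness into two comparisons of numbers. -/
theorem and_bitMask_iff (x r : ℕ) :
    x &&& bitMask r = 0 ∨ x &&& bitMask r = bitMask r ↔
      ∀ n < 4, ∀ n' < 4, x.testBit (r * n) = x.testBit (r * n') := by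
  have hm : ∀ n < 4, (bitMask r).testBit (r * n) = true := fun n hn =>
    (testBit_bitMask _ _).2 ⟨n, hn, rfl⟩
  constructor
  · rintro (h | h) n hn n' hn'
    · have key : ∀ n < 4, x.testBit (r * n) = false := fun n hn => by
        have := congrArg (fun y => y.testBit (r * n)) h
        simpa [hm n hn] using this
      rw [key n hn, key n' hn']
    · have key : ∀ n < 4, x.testBit (r * n) = true := fun n hn => by
        have := congrArg (fun y => y.testBit (r * n)) h
        simpa [hm n hn] using this
      rw [key n hn, key n' hn']
  · intro h
    have h0 : ∀ k, (bitMask r).testBit k = true → x.testBit k = x.testBit (r * 0) := fun k hk => by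
      obtain ⟨n, hn, rfl⟩ := (testBit_bitMask _ _).1 hk
      exact h n hn 0 (by norm_num)
    cases hx : x.testBit (r * 0)
    · left
      refine Nat.eq_of_testBit_eq fun k => ?_
      cases hk : (bitMask r).testBit k
      · simp [hk]
      · rw [Nat.testBit_and, h0 k hk, hx, Bool.false_and, Nat.zero_testBit]
    · right
      refine Nat.eq_of_testBit_eq fun k => ?_
      cases hk : (bitMask r).testBit k
      · simp [hk]
      · rw [Nat.testBit_and, h0 k hk, hx, Bool.true_and, hk]

/-- The regrouping reflects the order of evaluation in `flatBit`: planes are subtracted first, then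
rows. -/
theorem ite_add_ite_eq_iff : ∀ a b c d a' b' c' d' : Bool,
    ((if a then 1 else 0) + (if b then 1 else 0) + (if c then 1 else 0) + (if d then 1 else 0) :
      ZMod 2) =
    (if a' then 1 else 0) + (if b' then 1 else 0) + (if c' then 1 else 0) + (if d' then 1 else 0) ↔
    ((a ^^ c) ^^ (b ^^ d)) = ((a' ^^ c') ^^ (b' ^^ d')) := by
  decide +kernel

open Classical in
theorem flatBit_eq (c p q r : ℕ) (u u' w w' : V4) :
    flatBit (bitMask r) ((c >>> (p * u.toNat)) ^^^ (c >>> (p * u'.toNat)))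
      (q * w.toNat) (q * w'.toNat) =
    if IsFlatTwist (bitTwist c ![p, q, r]) u u' w w' then 1 else 0 := by
  have h : IsFlatTwist (bitTwist c ![p, q, r]) u u' w w' ↔
      ∀ n < 4, ∀ n' < 4,
        ((((c >>> (p * u.toNat)) ^^^ (c >>> (p * u'.toNat))) >>> (q * w.toNat)) ^^^
        (((c >>> (p * u.toNat)) ^^^ (c >>> (p * u'.toNat))) >>> (q * w'.toNat))).testBit (r * n) =
        ((((c >>> (p * u.toNat)) ^^^ (c >>> (p * u'.toNat))) >>> (q * w.toNat)) ^^^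
        (((c >>> (p * u.toNat)) ^^^ (c >>> (p * u'.toNat))) >>> (q * w'.toNat))).testBit
          (r * n') := by
    have key : ∀ s s' : V4, twistBox (bitTwist c ![p, q, r]) u u' w w' s =
        twistBox (bitTwist c ![p, q, r]) u u' w w' s' ↔
        ((((c >>> (p * u.toNat)) ^^^ (c >>> (p * u'.toNat))) >>> (q * w.toNat)) ^^^
        (((c >>> (p * u.toNat)) ^^^ (c >>> (p * u'.toNat))) >>> (q * w'.toNat))).testBit
          (r * s.toNat) =
        ((((c >>> (p * u.toNat)) ^^^ (c >>> (p * u'.toNat))) >>> (q * w.toNat)) ^^^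
        (((c >>> (p * u.toNat)) ^^^ (c >>> (p * u'.toNat))) >>> (q * w'.toNat))).testBit
          (r * s'.toNat) := fun s s' => by
      simp only [twistBox, bitTwist, Fin.sum_univ_three, Matrix.cons_val_zero, Matrix.cons_val_one,
        Matrix.cons_val, ite_add_ite_eq_iff, Nat.testBit_xor, Nat.testBit_shiftRight]
      simp only [add_assoc]
    constructor
    · intro h n hn n' hn'
      obtain ⟨s, rfl⟩ := V4.exists_toNat n hn
      obtain ⟨s', rfl⟩ := V4.exists_toNat n' hn'
      exact (key s s').1 (h s s')
    · intro h s s'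
      exact (key s s').2 (h _ s.toNat_lt _ s'.toNat_lt)
  rw [h, ← and_bitMask_iff]
  simp only [flatBit, cond_eq_ite, Bool.or_eq_true, Nat.beq_eq]
  congr

theorem flatBit_comm (m d j j' : ℕ) : flatBit m d j j' = flatBit m d j' j := by
  simp only [flatBit, Nat.xor_comm (d >>> j)]

theorem flatBit_self (m d j : ℕ) : flatBit m d j j = 1 := by
  simp [flatBit]

-- Boxes with `w = w'` are always flat, giving 4 for each of the four planes `u'`; the others come
-- in pairs under swapping `w` and `w'`. Hence `16 + 2 * _`, and the 8 in `planeCount`.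
open Classical in
theorem twistCount_bitTwist (c p q r : ℕ) (u : V4) :
    twistCount (bitTwist c ![p, q, r]) u = 2 * planeCount c p q r u.toNat := by
  simp only [twistCount, ← flatBit_eq]
  have h : ∀ m d : ℕ, (∑ w : V4, ∑ w' : V4, flatBit m d (q * w.toNat) (q * w'.toNat)) =
      4 + 2 * pairCount m q d := fun m d => by
    rw [V4.sum_toNat (fun n => ∑ w' : V4, flatBit m d (q * n) (q * w'.toNat))]
    simp only [fun n => V4.sum_toNat (fun n' => flatBit m d (q * n) (q * n'))]
    simp only [flatBit_self, flatBit_comm m d (q * 1) (q * 0), flatBit_comm m d (q * 2) (q * 0),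
      flatBit_comm m d (q * 3) (q * 0), flatBit_comm m d (q * 2) (q * 1),
      flatBit_comm m d (q * 3) (q * 1), flatBit_comm m d (q * 3) (q * 2), pairCount]
    ring
  simp only [h]
  rw [V4.sum_toNat (fun n =>
    4 + 2 * pairCount (bitMask r) q ((c >>> (p * u.toNat)) ^^^ (c >>> (p * n))))]
  simp only [planeCount]
  ring

theorem flatCount_twist_bitTwist (c p q r : ℕ) (i : Fin 16) :
    flatCount (twist (bitTwist c ![p, q, r])) i =
      128 * planeCount c p q r (coord i).1.toNat := by
  rw [flatCount_twist, twistCount_bitTwist]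
  ring

theorem flatMoment_twist_bitTwist (c p q r : ℕ) :
    flatMoment (twist (bitTwist c ![p, q, r])) = 4 * 128 ^ 3 * planeMoment c p q r := by
  have hs : (fun t => (![p, q, r] : Fin 3 → ℕ) (Equiv.swap 1 2 t)) = ![p, r, q] := by
    funext t
    fin_cases t <;> rfl
  simp only [flatMoment, conjugate_twist_bitTwist, hs, flatCount_twist_bitTwist]
  rw [sum_coord_fst (fun u => (128 * planeCount c p q r u.toNat) ^ 2 *
    (128 * planeCount c p r q u.toNat)), V4.sum_toNat (fun n => (128 * planeCount c p q r n) ^ 2 *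
    (128 * planeCount c p r q n))]
  simp only [planeMoment]
  ring

theorem sum_perm_three (f : Equiv.Perm (Fin 3) → ℕ) :
    ∑ γ, f γ = f 1 + f (Equiv.swap 1 2) + f (Equiv.swap 0 1) + f (finRotate 3) +
      f (finRotate 3)⁻¹ + f (Equiv.swap 0 2) := by
  have h : (univ : Finset (Equiv.Perm (Fin 3))) = {1, Equiv.swap 1 2, Equiv.swap 0 1, finRotate 3,
    (finRotate 3)⁻¹, Equiv.swap 0 2} := by decide
  rw [h, sum_insert (by decide), sum_insert (by decide), sum_insert (by decide),
    sum_insert (by decide), sum_pair (by decide)]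
  simp only [← add_assoc]

/-! ### Codes as certificates for inequivalent non-group cubes -/

/-- The cube with code `c`. -/
noncomputable def codeCube (c : ℕ) : Cube 3 16 := twist (bitTwist c ![16, 4, 1])

theorem strides_comp (γ : Equiv.Perm (Fin 3)) (a : Fin 3 → ℕ) :
    (fun t => a (γ t)) = ![a (γ 0), a (γ 1), a (γ 2)] := by
  funext t
  fin_cases t <;> rfl

/-- The six conjugates correspond to the six orders of the strides 16, 4, 1, so the invariant is
computable from the code although the labelling `coord` is arbitrary. -/
theorem flatInvariant_codeCube (c : ℕ) :
    flatInvariant (codeCube c) = (4 * 128 ^ 3) ^ 2 * codeInvariant c := by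
  have h : ∀ γ : Equiv.Perm (Fin 3), flatMoment (conjugate γ (codeCube c)) ^ 2 =
      (4 * 128 ^ 3) ^ 2 * planeMoment c ((![16, 4, 1] : Fin 3 → ℕ) (γ 0))
        ((![16, 4, 1] : Fin 3 → ℕ) (γ 1)) ((![16, 4, 1] : Fin 3 → ℕ) (γ 2)) ^ 2 := fun γ => by
    rw [codeCube, conjugate_twist_bitTwist, strides_comp, flatMoment_twist_bitTwist, mul_pow]
  simp only [flatInvariant, h]
  rw [← mul_sum, sum_perm_three]
  rfl

/-- The code vanishes where the twisting function has to, and the numbers of flat boxes are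
not constant in two directions. -/
def isGoodCode (c : ℕ) : Bool :=
  (c &&& 0x1248218448128421).beq 0 &&
    !(planeCount c 16 4 1 0).beq (planeCount c 16 4 1 1) &&
    !(planeCount c 4 1 16 0).beq (planeCount c 4 1 16 1)

/-- The mask has one bit in each hexadecimal digit: for every `x`, `y` it marks the unique `z = x +
y`. -/
theorem testBit_zeroMask : ∀ x y z : V4, x + y + z = 0 →
    (0x1248218448128421).testBit (16 * x.toNat + 4 * y.toNat + 1 * z.toNat) = true := by
  decide +kernel

theorem codeCube_mem_nonGroupCubes {c : ℕ} (hc : isGoodCode c = true) :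
    codeCube c ∈ nonGroupCubes 2 16 6 2 := by
  simp only [isGoodCode, Bool.and_eq_true, Nat.beq_eq, Bool.not_eq_true',
    ← Bool.not_eq_true] at hc
  obtain ⟨⟨hz, h0⟩, h1⟩ := hc
  have hn : ∀ n < 4, ∃ i, (coord i).1.toNat = n := fun n hn => by
    obtain ⟨u, rfl⟩ := V4.exists_toNat n hn
    exact ⟨coord.symm (u, 0), by simp⟩
  obtain ⟨i, hi⟩ := hn 0 (by norm_num)
  obtain ⟨i', hi'⟩ := hn 1 (by norm_num)
  refine mem_nonGroupCubes_of_flatCount_ne (i := i) (i' := i') (j := i) (j' := i')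
    (twist_mem_designCubes fun s hs => ?_) ?_ ?_
  · rw [Fin.sum_univ_three] at hs
    have := congrArg (fun y => y.testBit
      (16 * (s 0).toNat + 4 * (s 1).toNat + 1 * (s 2).toNat)) hz
    simp only [Nat.testBit_and, testBit_zeroMask _ _ _ hs, Bool.and_true, Nat.zero_testBit] at this
    unfold bitTwist
    rw [Fin.sum_univ_three]
    exact if_neg (by simpa using this)
  · rw [codeCube, flatCount_twist_bitTwist, flatCount_twist_bitTwist, hi, hi']
    omega
  -- Rotating brings direction 1 to the front, which is the order of strides tested by `isGoodCode`.
  · have hr : (fun t => (![16, 4, 1] : Fin 3 → ℕ) (finRotate 3 t)) = ![4, 1, 16] := by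
      rw [strides_comp]
      rfl
    rw [codeCube, conjugate_twist_bitTwist, hr, flatCount_twist_bitTwist,
      flatCount_twist_bitTwist, hi, hi']
    omega

/-- The codes in the list are good, and their invariants are increasing and larger than `k`. -/
def checkCodes : ℕ → List ℕ → Bool
  | _, [] => true
  | k, c :: l => k.blt (codeInvariant c) && isGoodCode c && checkCodes (codeInvariant c) l

/-- Sorting by invariant lets one linear pass certify pairwise distinctness; the bound `k` carries
the last invariant through the induction. -/
theorem checkCodes_spec {k : ℕ} {l : List ℕ} (h : checkCodes k l = true) :
    (∀ c ∈ l, k < codeInvariant c ∧ isGoodCode c = true) ∧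
      l.Pairwise (fun c c' => codeInvariant c < codeInvariant c') := by
  induction l generalizing k with
  | nil => simp
  | cons c l ih =>
    simp only [checkCodes, Bool.and_eq_true, Nat.blt_eq] at h
    obtain ⟨⟨hk, hg⟩, hl⟩ := h
    obtain ⟨h1, h2⟩ := ih hl
    refine ⟨fun d hd => ?_, List.pairwise_cons.2 ⟨fun d hd => (h1 d hd).1, h2⟩⟩
    rcases List.mem_cons.1 hd with rfl | hd
    · exact ⟨hk, hg⟩
    · exact ⟨hk.trans (h1 d hd).1, (h1 d hd).2⟩

theorem exists_nonGroupCubes_of_checkCodes {k : ℕ} {l : List ℕ} (h : checkCodes k l = true) :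
    ∃ C : Fin l.length → Cube 3 16, (∀ a, C a ∈ nonGroupCubes 2 16 6 2) ∧
      ∀ a b, a ≠ b → ¬ Equivalent (C a) (C b) := by
  obtain ⟨h1, h2⟩ := checkCodes_spec h
  refine ⟨fun a => codeCube (l.get a),
    fun a => codeCube_mem_nonGroupCubes (h1 _ (l.get_mem a)).2, fun a b hab hE => ?_⟩
  have hi := hE.flatInvariant_eq
  simp only [flatInvariant_codeCube] at hi
  have hi' := Nat.eq_of_mul_eq_mul_left (by positivity) hi
  rcases lt_or_gt_of_ne hab with hlt | hlt
  · exact absurd hi' (List.pairwise_iff_get.1 h2 a b hlt).ne'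
  · exact absurd hi' (List.pairwise_iff_get.1 h2 b a hlt).ne

/-- Codes of pairwise inequivalent non-group cubes, ordered by their invariants. -/
def codes : List ℕ :=
  [0x84124010280, 0x41210804810, 0x42381202040, 0x3124411204, 0x86824080306, 0x84023010352,
   0x102884201142, 0x81a0408280c, 0x60205c40148, 0x248072c0190, 0x41820841812, 0x821a0095182,
   0x4810243082, 0xa3a01296002, 0x2a82012140, 0x8422008680a, 0x3130a90a40, 0x102824813048,
   0x6221028005c, 0x86003054208, 0x4180247a00, 0x1305814800, 0x24814042108, 0x2804a10a0c,
   0x104204052812, 0x81122a04890, 0x82810041842, 0x24324083218, 0x100812402218, 0x24820803a02,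
   0x24810240284, 0x2881253002, 0x25820ac031a, 0x24121881802, 0x46384204104, 0x3220080814,
   0x238a201484a, 0x12040101d8, 0x6503621305c, 0x240042c5980, 0x4181340100a, 0x6231051800,
   0x64303800012, 0x4880240284, 0x24100a42a08, 0x3904251046, 0x1210883140, 0x42905c05390,
   0x21a20011042, 0x628860131c8, 0x839008d10d4, 0x212024409d8, 0x21824a00150, 0x640842c008a,
   0x21883200282, 0x1891203040, 0x1232445310, 0x40380e501c0, 0x4a8060108c, 0x41820084180,
   0x41820846008, 0x84100a849c2, 0x1821005814, 0x3110840242, 0x1032304051c0, 0xa180104201c,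
   0x4214200208, 0x4201648108a, 0x100902410184, 0x41a461419a, 0x62810a44892, 0x41221284202,
   0x8302301400a, 0x21090413008, 0x240052c500c, 0x4321020128c, 0x52806c0358, 0x282041014a,
   0xa08018d400e, 0x25012040a48, 0x3181c43088, 0x26322814080, 0x21a80041208, 0x21182044102,
   0x612428410c, 0x431920402c0, 0x60216054018, 0x103a12c02990, 0x1207a409c0, 0x2813003042,
   0x2031168605c, 0x24a35400084, 0x26aa1801288, 0x1882040344, 0x61a27801248, 0x10081484418a,
   0x4132404212, 0xa0200644210, 0x82101246000, 0x1280c14080, 0x201840c4002, 0x2134280118,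
   0x203104c4002, 0x6a05096114, 0x20820891840, 0x40181200082, 0x41302804210, 0x83001291280,
   0x2810400342, 0x24030286804, 0x4884012108, 0x283440104c, 0x60205046208, 0x4210149208a,
   0x212a4092056, 0x85904045810, 0xa82410b12, 0xa4800a02358, 0x2130680082, 0x240002451d8,
   0x2325600244, 0x21884c00882, 0xc4a81080248, 0x24300c40812, 0x81192c040d4, 0x1202611084,
   0x4812800a90, 0x201810c1040, 0x243a0200904, 0x420a0c81008, 0x468224842c0, 0x24820041840,
   0xc4821885290, 0xa4100810904, 0x6301c01388, 0x1814802102, 0x6281091202, 0x5924015200,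
   0x5931200912, 0x40824a02818, 0x60230a42812, 0x418b0085900, 0x2810054016, 0x20880014012,
   0x4212042300, 0x2804801054, 0x420a3090144, 0x4221280500a, 0xc1201850140, 0x20a04604082,
   0x40821882140, 0x22110a84050, 0xa092180095a, 0x609a1083386, 0x821a0a002c8, 0x40912811084,
   0x3120404018, 0x4282017004, 0x20801241840, 0x40210480248, 0x60282287b06, 0x102381a0300a,
   0x4114201084, 0xc6204210880, 0x6a25c1500c, 0x23015811248, 0x4204010284, 0x102106250890,
   0x6800c521c0, 0x21080414200, 0x102031002148, 0x85015240280, 0x11912c4248, 0x930602840,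
   0x2124a01210, 0x4010140081c, 0x241a0c04050, 0x40200242184, 0x828860120c0, 0x6880211080,
   0x81082c048d4, 0x24220a40198, 0x1295a02a04, 0x40a81411840, 0x58a0640140, 0x1a90242880,
   0x42800486080, 0x42b14061c0, 0x1a20010340, 0x1303817280, 0x868a2000256, 0x809200c0a12,
   0x62890c80082, 0x103220485080, 0x41080011182, 0x2b8048204c, 0x40182c01042, 0x43020a41208,
   0x2984a46008, 0x64280014800, 0x1382004804, 0x48a2081002, 0x2a0624234a, 0x1226040146,
   0x23024491214, 0x1280240204, 0x410804c2080, 0x40230600a08, 0x4390200288, 0x2802844080,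
   0x23024c11092, 0x241a0c43000, 0x4112002808, 0x2981c43900, 0x4104205208, 0x5820484214,
   0x6830011846, 0xa248441c2, 0x1a06012102, 0x25800412800, 0x121004429c, 0x4131040906,
   0x40800281240, 0x61004213004, 0x42280214840, 0x81082c440d4, 0x394012b14, 0x40120c81002,
   0x21004203006, 0x21002850a42, 0x42820100c8, 0x320483204, 0x7915c93204, 0x261050d2082,
   0x3081804018, 0x423130c3a00, 0x2831441042, 0x21804050112, 0x980440184, 0x912400a44,
   0x1106402810, 0x68140843ca, 0x21012840a50, 0x64002804190, 0x1130084206, 0x882402150,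
   0x1024882140, 0x1890840896, 0x2021882340, 0x4821091800, 0x1006cc6308, 0x6330090800,
   0x801a1046b42, 0x40380c11088, 0x40821c00140, 0x6210200804, 0x480328100c, 0xa301008080c,
   0x210264c4088, 0x63380483142, 0x18128110d2, 0x1224400158, 0x1a31002198, 0x4282044308,
   0x43810420cc, 0x448808120c0, 0x6a30202042, 0x24281003882, 0x242a44c304a, 0x261100821c0,
   0x20991804810, 0x25002041a02, 0x4204282100, 0x841006040c8, 0x44890804900, 0x1206052812,
   0x2920840310, 0x219024010c4, 0x490421030c, 0x44125010042, 0x42994282812, 0x2821297094,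
   0x640a2004018, 0x23104040182, 0x2214086048, 0x6890ac2300, 0x1204680280, 0x4184000204,
   0x104002084050, 0x262b10800cc, 0x2300416a00, 0x42114082808, 0x2801441280, 0x2821c00084,
   0x22104042a9c, 0x26b01c12108, 0x451114902d4, 0x190744014a, 0x80985403800, 0x812106c1086,
   0x64012a81804, 0x7104241a0c, 0x981c00388, 0x22080841048, 0x52848d4242, 0x21024080840,
   0x45181a0010a, 0x21006c2148, 0x310c84208, 0x40134801808, 0x50018c400c, 0x980412840,
   0x2a95012080, 0x24801280180, 0x2210a44818, 0x92081094a, 0x240102c5008, 0x1281242888,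
   0x301412a10, 0x910207210, 0x620141280c, 0x48100c1a40, 0x221886140, 0xa24c040d8, 0x2205411042,
   0xaa0812048, 0x24004201048, 0x1890c00a00, 0x20806045b02, 0x5a20c0300a, 0x9840c2808,
   0x1202011840, 0x23180050108, 0x2111042086, 0x2882201280, 0x5083400106, 0xa3011446050,
   0x2093004ac0, 0x1880814284, 0x19020284e, 0x24920014290, 0x806a0210c, 0x82130610004, 0x182000912,
   0x904284200, 0x27a80210004, 0xa08908c4112, 0x6280040950, 0x7982e02b02, 0x2a04010188,
   0x41205a02056, 0x82095001040, 0x43884640204, 0x2804090188, 0x28040c4100, 0x21a04203004,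
   0x62010882084, 0x4880241006, 0x452120c6000, 0x5195082848, 0x20804481900, 0x1830e40844,
   0x281488201c, 0x2101640208, 0x104004050852, 0x3105014112, 0x12040542c2, 0x128400320c,
   0x28168430c0, 0x81802880194, 0x64080443210, 0x3004a82004, 0x41814042158, 0x30214c1b88,
   0x21b91085242, 0x408118801c4, 0x20124202804, 0xa4912214090, 0x202a140530a, 0x101314411348,
   0xa02406102, 0x131080500c, 0x65024040012, 0x1221a00808, 0x80992a44a40, 0xc020504600a,
   0x24005215210, 0x382010294, 0xa03404a98, 0x42082010046, 0x21083405000, 0x2980801802,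
   0x86202211212, 0x608814100ca, 0x208a0c90104, 0x5124205800, 0x7821041804, 0x1300452a08,
   0x23000444142, 0x2810804884, 0x1226015240, 0x6114686006, 0x41291800210, 0x23124c12016,
   0x4115006084, 0x85102c040d4, 0x312044080, 0x9930d1800, 0x20a16006290, 0x21280601082,
   0x3b91a00812, 0x1904150c8, 0x24a20240346, 0x31a0012040, 0x84090602014, 0x232444190,
   0x42100400218, 0x114092088, 0x802c52140, 0x21084213000, 0x21004a03204, 0x21812447300,
   0x2b006d1808, 0x104801048, 0x80202085390, 0xa10600148, 0x203108c2282, 0x101842080,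
   0xa0235002118, 0x64122004110, 0x12180680a, 0x3a2248419c, 0x6082014808, 0x1024082284,
   0x25800402a08, 0x1802a84100, 0x42840002c8, 0x5210084204, 0x20830045a0e, 0x7131000184,
   0x2b05084880, 0x1202645040, 0x103330480054, 0x1201093800, 0x1202054014, 0xa0107412004,
   0x302802108, 0x5a16805304, 0xa21882140, 0x2884482340, 0x924802808, 0x4294881198, 0x7212210b54,
   0x1130909c8, 0x41920890808, 0x2106485092, 0x32144031a, 0x44007281908, 0xc0083c10286,
   0xa1824210012, 0x120600208c, 0x100201840a52, 0x40880011040, 0x1280402800, 0x380492800,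
   0x1804401084, 0x1020414300, 0x985201200, 0x80212005140, 0x2190000380, 0x1801c41200,
   0x20130410804, 0x1aa0800248, 0x101240340, 0x46022c44284, 0x2801080390, 0x429a2080042,
   0x84301480202, 0x6a144c0900, 0x2010842a04, 0x910842082, 0x210440814, 0x1206014004, 0x90260190a,
   0x121a4280a, 0x21880000184, 0x102802890, 0x21004203104, 0xaa0285348, 0x124c02810, 0x203401048,
   0x42020c85000, 0x184c02042, 0x24113080002, 0x98104108e, 0x40120205300, 0x44a14600bda,
   0x80420120c, 0x63006a06100, 0x2100890a08, 0x300c90a48, 0x39000c5092, 0x902482880, 0x3a84202282,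
   0x220884180, 0x380811840, 0x9022c0812, 0x2a1c40a04, 0x1086000842, 0x50364c024a, 0x1092040144,
   0x120c03280, 0x106040216, 0x62104c0908, 0x5b2569499a, 0x2801406200, 0x1a10200840, 0x1802084080,
   0x44114804300, 0x2884601040, 0x1913a54208, 0x6320084818, 0x22a0090154, 0x4a02800016,
   0x4280094280, 0x310452a00, 0x13800d2108, 0x2204081804, 0x110241314a, 0x2a27a00a14, 0x1326000086,
   0x2804040312, 0x2814000054, 0x190404428c, 0x302404810, 0x201404180, 0x20100884082, 0x310412a10,
   0x2180481002, 0x1021285294, 0x2820886004, 0x2192003004, 0x814804182, 0x905614102, 0x1202a95240,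
   0x20983000182, 0x380412a00, 0x1a1268008c, 0x19a3002204, 0x80831000294, 0x3082042900,
   0x1a10800804, 0x84010800390, 0x20223453bd2, 0x826040210, 0x386a01088, 0x4212416ac0,
   0x1204205000, 0x12a1002116, 0x224014280, 0x210681ad0, 0x1100244102, 0x302802018, 0x1a80841882,
   0xa80c14010, 0x121090280, 0x270000c2118, 0x183a41a08, 0x10044948c0, 0x301212140, 0x1812a04000,
   0x902480a44, 0x312084200, 0x13a00512c0, 0x2020a10a06, 0x42011001280, 0x26204c13808,
   0x2018209018c, 0x320a41200, 0x101292958, 0x24884011000, 0x232480910, 0x1801a02000, 0x1007c12bc0,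
   0x304413a08, 0x1880404098, 0x2102421300c, 0x1020a8400a, 0x1220250810, 0x305011304, 0x121052040,
   0x1024040d8, 0x300416a00, 0x300412b10, 0x380416004, 0x30008c2158, 0x9930c100a, 0x884041054,
   0x9124003c4, 0x1120a46106, 0x230041908, 0x22501138a, 0x184200304, 0x101244002, 0x101442014,
   0x202642804, 0xc0110893004, 0x4a80850198, 0x80226001248, 0x1b02084080, 0x1202804880,
   0x84280092010, 0x3a1402804, 0x41026013008, 0x41204481200, 0x2883401340, 0x1280440a10,
   0x52802c6000, 0x1190053b80, 0x2886404100, 0x120802308, 0x20282a40108, 0x22101810810,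
   0x18204d4200, 0x1312216150, 0x301492a00, 0x40910280880, 0x20100485000, 0x1904041804,
   0x5013804300, 0x4003091280, 0x1205800048, 0x920804a10, 0x310410954, 0x931400148, 0x18a0004842,
   0x180401804, 0x1002091094, 0x24004204118, 0x26022881004, 0x4006811804, 0x380612a00,
   0x4923040a00, 0x40020c4812, 0x7182286004, 0x7a20802300, 0x201040508ca, 0x901a02308,
   0x1801405002, 0x112400248, 0x2140450c4, 0xa01480a52, 0x801204210, 0x910211054, 0x101484910,
   0x1214c80800, 0x1180280842, 0x40220892212, 0xa85000142, 0x9210c2804, 0x4408084204e,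
   0xc710440201c, 0x201883140, 0x384412a00, 0x20804041902, 0x40102086012, 0x102100a86000,
   0x1304001080, 0x20a16806000, 0x910884014, 0x23288430a, 0x1204001880, 0x29842001c8, 0x102800184,
   0x3803410308, 0x812812218, 0x44104056300, 0x3930c1200, 0x121a82140, 0x308149604e, 0x21a04140c0,
   0x204c07140, 0x1034802004, 0x1810800a00, 0x912400054, 0xa81840146, 0x9818008c2, 0x924880208,
   0x201091a80, 0x121084104, 0x300c42810, 0x110264010c, 0x804014182, 0x4824e4230c, 0x21304212000,
   0x102041084, 0x100c80182, 0x5122491084, 0x24101001254, 0x290c80208, 0x102040142, 0x101841800,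
   0x23004c601a, 0x806011284, 0x184200114, 0x880011802, 0x20314040048, 0x1a02201240, 0xa820c4200,
   0x210614108, 0x1820400190, 0x80104a42108, 0x210643806, 0x3082402884, 0x2080401300c,
   0x1810801a00, 0x21810092010, 0x60b10800902, 0x20800684186, 0x7113c11840, 0x203402084,
   0x29124000c0, 0x4226c04154, 0x4102a04010, 0xa108010c8, 0x8a3401140, 0x3010040198, 0x66080013140,
   0x990a010c0, 0x40184802008, 0x49a0295040, 0x1900050ac4, 0x1220850084, 0x130212a48, 0x102480840,
   0x2068048c0, 0x1080457240, 0x2a2041044, 0x1024002c4, 0x300294100, 0x1105800058, 0x92488080a,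
   0x12a1650840, 0x201082086, 0x230280054, 0x202611282, 0x111842800, 0xa03c82810, 0x201680810,
   0x3a0040184, 0x1104012058, 0x101444058, 0x2102424300c, 0x120044284, 0x10481018a, 0x201851140,
   0x301440886, 0x2108d0306, 0x213802088, 0x102841044, 0x100240912, 0x20328208a, 0xa81856800,
   0x24104411004, 0x122811848, 0x300412a08, 0x130092a00, 0x2104001002, 0x101800842, 0x184404310,
   0x4a21040050, 0x125081800, 0x1206003c8, 0x100482ac8, 0x45100641000, 0x101082048, 0x2060c6100,
   0x107205350, 0x100242a48, 0x1302001840, 0x205010180, 0x120403008, 0x1101a80880, 0x105280016,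
   0x21280004a00, 0x6912c04800, 0x26884000240, 0x4210082152, 0x411a0053142, 0x112881248,
   0x6133004280, 0x4834001002, 0x1206086280, 0x1220840800, 0x4810890290, 0x82a00042058,
   0xc480001634e, 0x1882000044, 0x22010050188, 0x2812411000, 0x60921203840, 0x1282886080,
   0x129508220c, 0x281240840, 0x28044010d4, 0x30040c4218, 0x201800c0184, 0x2b01800290,
   0x2803000054, 0x321444002, 0x300496a00, 0x904804110, 0x906012040, 0x20132004800, 0x304412a00,
   0x20281242258, 0x2281000190, 0x2910051200, 0x120801802, 0x1002842088, 0xa02401002, 0x4180000982,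
   0x2210400c8, 0x300614200, 0x390040210, 0x130800a42, 0x102410258, 0x912400244, 0x300492a00,
   0x102045090, 0x924a0500a, 0x101446804, 0x22821081100, 0x1084082a40, 0x13242800c0, 0x101081284,
   0x104c44092, 0x23102481010, 0x183050380, 0x215040940, 0x2820205106, 0x182200380, 0x121414002,
   0x4112804884, 0x9808428c2, 0x8800c421c, 0x29a0850a10, 0x182406180, 0x182000284, 0x206011082,
   0x8300128c8, 0x127812040, 0x212243842, 0x100244804, 0x100840146, 0x190a042d0, 0x910cc0908,
   0x101042080, 0x120404902, 0x220014180, 0x6314410300, 0x131203008, 0x904216880, 0x906413000,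
   0x114210108, 0x10144221a, 0x104290018, 0x105084156, 0xa80c40900, 0x181400114, 0x1010408c0,
   0x1058c0102, 0x1104c0104, 0x9006c0a00, 0x8180428000a, 0x4831002044, 0x2180000018a, 0x284c93014,
   0x212084808, 0x1280211200, 0x21980440010, 0x1800242100, 0x38010d3004, 0x981044018, 0x3884804a80,
   0x180202084, 0x1021802108, 0x1121882140, 0x42124c0900, 0x20193000090, 0x2881895000,
   0x1210042108, 0x2200ac214e, 0x1102084200, 0x20a87400250, 0x310c06802, 0x4830000290, 0x134080290,
   0x600018c500a, 0x800414182, 0x2202389121a, 0x6030400a02, 0x1030800812, 0x801040842,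
   0x20193610040, 0x2240108c0, 0x2044141d8, 0x102841050, 0x6014002218, 0x136410304, 0x120804042,
   0x1221411200, 0x100841048, 0x1807094000, 0x200411808, 0x20220083840, 0x212e94108, 0x102a04008,
   0x120440a08, 0x201485818, 0x114200990, 0x520181000c, 0x20906041000, 0x23060488c, 0x4320486000,
   0xa20c50900, 0xa14802002, 0x600300014a, 0x100492080, 0x4030800214, 0x820896806, 0x1002816080,
   0x123000a08, 0x104840108, 0x192400094, 0x104c01040, 0x112800a10, 0x300493a80, 0x3060c2804,
   0x101040380, 0x101041802, 0x1248002d0, 0x83488090c, 0x603a0c000c0, 0x21800000184, 0x5092800816,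
   0x24001200880, 0x1813000844, 0x1232004a00, 0x1882810042, 0x12a0080840, 0x42010001240,
   0x200840ac0, 0x205017902, 0x380481856, 0x280204018, 0x104203004, 0x100244800, 0x104800902,
   0x235c040c0, 0x1114853188, 0x62091000090, 0x12a0000108, 0x820c4188c, 0x30120700e, 0x1030408c0,
   0x1282400808, 0x201042140, 0x1004283004, 0x127812180, 0x12054c4000, 0xa84443280, 0x8a0200014,
   0x102841016, 0x5082080194, 0x104082090, 0x102085040, 0x1320403000, 0x382242246, 0x1010c08c0,
   0xa100460c0, 0x310800a00, 0x102840804, 0x300412b00, 0x103084892, 0x100280240, 0xa84882018,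
   0x102402280, 0x800242804, 0x30000c2108, 0x102052a00, 0x300492a10, 0x100284208, 0x300204802,
   0x100240240, 0x801243884, 0x101483000, 0x111085048, 0x10089104c, 0x101050240, 0x101400818,
   0x101041204, 0x20106090802, 0x2205410a44, 0x1048020c4, 0x302804804, 0x6084284002, 0x112410182,
   0x18a1000042, 0x312800a08, 0x24150c0, 0x1018048c0, 0x806043200, 0x1144c0212, 0x230084180,
   0x4990002048, 0x201480084, 0x60020610050, 0x20024481084, 0x101402194, 0x217203008, 0x35002148,
   0x2230480012, 0x100247190, 0x121a00204, 0x22814a922c2, 0x20484818, 0x884855208, 0x322800144,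
   0x921000802, 0x98020020c, 0x122481acc, 0x11200d2b82, 0x180440908, 0x103080288, 0x2014081b14,
   0x300612a40, 0x114016040, 0x124014240, 0x301882002, 0x100c43800, 0x920800a00, 0x101204080,
   0x113441212, 0x103c02900, 0x100281204, 0x3003c0018c, 0x104815050, 0x810242110, 0x204483010,
   0x132080808, 0x187042808, 0x102843000, 0x1822441c0, 0x110284004, 0x124880808, 0x102201284,
   0x200603208, 0x110440810, 0x100601a08, 0x190240300, 0x101082384, 0x101284000, 0x5201440096,
   0x2081040104, 0x107291ac8, 0xa2180104e, 0xa02e42050, 0x26110002340, 0x305084080, 0x20980240880,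
   0x900cc1800, 0x911245300, 0x360180a, 0x100284088, 0x30240853c0, 0x300841200, 0x23300038a,
   0x10024120a, 0x126a8300c, 0x190090842, 0x100292040, 0x103400204, 0x220401280, 0x2a04d0a04,
   0x180240a00, 0x100855088, 0x902c102c4, 0x1102c2240, 0x32045204c, 0xa00c10900, 0x120c81008,
   0x12284015a, 0x282284900, 0x111487910, 0x110440058, 0x102a00208, 0x120202840, 0x101040240,
   0x100a01ac8, 0x305004014, 0x111440304, 0x23100010a, 0x181242000, 0x100683250, 0x21800001840,
   0x100886012, 0x981010810, 0xa02800a58, 0x24800002810, 0x101254000, 0x41800001208, 0x1930c3000,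
   0x10200091c, 0x24201804900, 0x14091882, 0x92480000a, 0x1026802180, 0x380440810, 0x46000096800,
   0x100240818, 0x102092080, 0x102040840, 0x310200808, 0x203014810, 0x854108, 0x200884102,
   0x120602008, 0x120086080, 0x122400a04, 0x102043180, 0x902410244, 0x10088620c, 0x100896280,
   0x110880804, 0x101815040, 0xa0000a04182, 0x10060085a, 0x103050840, 0x100440280, 0x102203804,
   0x101240090, 0x1020008c4, 0x101402102, 0x1a4000806, 0x101480200, 0x100643000, 0x64002c00110,
   0x105284000, 0x121080800, 0x114412a00, 0x10a40a90, 0x332084880, 0x180a02100, 0x210086b80,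
   0x105044800, 0x1081842, 0x122001244, 0x180084810, 0x180441180, 0x981480a00, 0x105002080,
   0x802400246, 0x300696092, 0x203012848, 0x1200044100, 0x114802000, 0x104604008, 0x104002b80,
   0x181806002, 0x101043104, 0x102004080, 0x100283200, 0x101a00292, 0xa0030002118, 0x100a03210,
   0x3030000c6, 0x100a02300, 0x12801244, 0x100202104, 0x10089108a, 0x2840a9a, 0x21882950,
   0x990a0000c, 0x12243890, 0x3004886200, 0x1042048, 0x100282800, 0x6084280a00, 0x250814,
   0x100245084, 0x1201000240, 0x2c2018, 0x1042a0c, 0x112200240, 0x310804008, 0x2010841004,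
   0x184004884, 0x2214040012, 0x1080812, 0x821055002, 0x100a42100, 0x282a02804, 0x105001882,
   0x1102803102, 0x100604902, 0x102001052, 0x130002098, 0x103005304, 0x2aa4891010, 0x100402890,
   0x1020040c0, 0x100c10b90, 0x20304050a00, 0x100202804, 0x102c10090, 0x164009c, 0xa03a0000c,
   0x291804, 0x1211298, 0x250142, 0x182e40100, 0x681840, 0x1043a14, 0x902450244, 0x305005004,
   0x102201980, 0x100c03040, 0x100241810, 0x120205800, 0x100240300, 0x1030060c2, 0x100204842,
   0x100204880, 0x100211808, 0x100216840, 0x8600309a, 0x180120a, 0x100044280, 0x101003804,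
   0x2418c0, 0x113890210, 0x1a40a02, 0x1c02a08, 0x112210804, 0xa12046, 0x100040142, 0x24884200000,
   0x284c0030c, 0x1030c008c, 0x160201c, 0x100883140, 0x100600904, 0x20280401010, 0x100246000,
   0x125800808, 0x100600a40, 0x100212800, 0x84810a00090, 0x100406050, 0x100202880, 0x4a16a00,
   0x100092180, 0x1082094, 0x1041908, 0x21882148, 0x100610240, 0x2051840, 0x1280210, 0x100200804,
   0x4540c2, 0x291048, 0x212140, 0x613810, 0x20104080900, 0x242108, 0x100041240, 0xa14018,
   0x454302, 0x8c4086, 0x100200104, 0x611084, 0x281208, 0x1000c0842, 0x1602180, 0x240284,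
   0x100040218, 0x2448c0, 0x1008c3140, 0x304010900, 0x6602180, 0x100402098, 0x18000028c,
   0x100a01818, 0x10020080a, 0x281a80, 0x100040280, 0x100044098, 0x906402244, 0x3a00c0300,
   0x83011218, 0x893940, 0x303000050, 0x10400704a, 0x29401a, 0x290198, 0xa448c0, 0x100042082,
   0x20100003080, 0x100042908, 0x100040214, 0xa80198, 0x101444100, 0x820690096, 0x100881080,
   0x10020201c, 0x100202300, 0xc83048, 0x100200112, 0x1450a04, 0x100602040, 0x100200802, 0x108201a,
   0x100881210, 0x120012800, 0x210852, 0x220882080, 0x100454100, 0x101680800, 0x100200102,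
   0x21882108, 0x280852, 0x100044190, 0x100040180, 0xcc4350, 0x101202000, 0x3000a90006, 0x11881814,
   0x5300002284, 0x54280, 0x100604090, 0x52814, 0x1092018, 0x100440900, 0x54012, 0x101080800,
   0xcc3140, 0x1046012, 0xc20c4, 0x105040140, 0xc4214, 0x100444100, 0x104402110, 0x100680800,
   0x103044040, 0x100880900, 0x100041a04, 0x100040150, 0xa130c0, 0x110045004, 0x101080808,
   0x802050a00, 0x101090800, 0xc0286, 0x102203000, 0x104005050, 0x100440200, 0x11284,
   0x20100000302, 0x100040140, 0x102000808, 0x690804, 0x8c3140, 0x95082, 0x1082108, 0x1080198,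
   0x50214, 0xc5300, 0x20104080000, 0x1014c, 0x20182000200, 0x5084a, 0x20100000102, 0xa02848,
   0x10248, 0x2c01c2, 0x50190, 0x20a00001810, 0x10294, 0x1044848, 0x1400a50, 0x52850, 0x50210,
   0x1024a, 0x50140, 0x13806, 0x500c6, 0x50150, 0x10242, 0x50094, 0x10240, 0x50058, 0x10816,
   0x10058, 0x52112, 0x4484884, 0x10046, 0x10042, 0x10012, 0x10054, 0x300000900, 0x11818, 0x1004a,
   0xc4884, 0x300000300, 0x346, 0x10044, 0x306, 0x100000200, 0x16, 0x102, 0x6, 0x2]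

theorem length_codes : codes.length = 1423 := by decide +kernel

/-- The initial bound 0 only asks the first invariant to be positive. -/
theorem checkCodes_codes : checkCodes 0 codes = true := by decide +kernel

end SymCube

/-- There are at least `1423` pairwise inequivalent non-group cubes in `𝒞³(16, 6, 2)`. -/
theorem proposition5p2 :
    ∃ C : Fin 1423 → SymCube.Cube 3 16,
      (∀ a, C a ∈ SymCube.nonGroupCubes 2 16 6 2) ∧
      ∀ a b, a ≠ b → ¬ SymCube.Equivalent (C a) (C b) := by
  have h := SymCube.exists_nonGroupCubes_of_checkCodes SymCube.checkCodes_codes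
  rwa [SymCube.length_codes] at h
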